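/- Let $A$ be a bounded linear operator on $\ell^2(\mathbb N)$ (complex scalars) which is a band operator, i.e. whose matrix $(A_{i,j})$ is supported on finitely many diagonals. Let $m\ge 1$ be a block size for which $A$, partitioned into $m\times m$ blocks, is block-tridiagonal (for bandwidth $b$ one can take any $m\ge\max(b,1)$, e.g. $m=b+1$; for tridiagonal $A$ one can take $m=1$). Let $\alpha=(\alpha_i)$ and $\gamma=(\gamma_i)$ be the sequences of the sub- and superdiagonal blocks, let $\|\alpha\|_\infty=\sup_i\|\alpha_i\|$, $\|\gamma\|_\infty=\sup_i\|\gamma_i\|$ with operator norms on Euclidean $\mathbb C^m$, and put $$\varepsilon_n=2(\|\alpha\|_\infty+\|\gamma\|_\infty)\sin\frac{\pi}{2(n+1)},\qquad n\in\mathbb N=\{1,2,\dots\}.$$ Let $A^*$ be the Banach space adjoint of $A$, acting on $\ell^2(\mathbb N)$ by the transposed (not conjugated) matrix. For $n\in\mathbb N$, $k\in\mathbb N_0$ let $E_{n,k}\subset\ell^2(\mathbb N)$ be the subspace of all sequences supported in the blocks number $k+1,\dots,k+n$. For $\varepsilon>0$ let $$\operatorname{spec}_\varepsilon A=\{\lambda\in\mathbb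 C:\|(A-\lambda I)^{-1}\|>1/\varepsilon\},$$ with $\|(A-\lambda I)^{-1}\|=\infty$ if $A-\lambda I$ is not invertible, and, for $B\in\{A,A^*\}$, $$\operatorname{spec}_\varepsilon (BP_{n,k})=\{\lambda\in\mathbb C:\ \inf\{\|(B-\lambda I)x\|: x\in E_{n,k},\ \|x\|=1\}<\varepsilon\}.$$ Put $$\Sigma_{\varepsilon,n}=\bigcup_{k\in\mathbb N_0}\bigl(\operatorname{spec}_\varepsilon(AP_{n,k})\cup\operatorname{spec}_\varepsilon(A^*P_{n,k})\bigr).$$ Then $$\Sigma_{\varepsilon,n}\ \subseteq\ \operatorname{spec}_\varepsilon A\ \subseteq\ \Sigma_{\varepsilon+\varepsilon_n,n}\qquad\text{for all }\varepsilon>0,\ n\in\mathbb N,$$ and, for every $\varepsilon>0$, both $\Sigma_{\varepsilon,n}$ and $\Sigma_{\varepsilon+\varepsilon_n,n}$ converge to $\operatorname{spec}_\varepsilon A$ in the Hausdorff distance as $n\to\infty$. -/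

import Mathlib

open scoped Topology

noncomputable section

/-- The complex Hilbert space `ℓ²(ℕ)`. The index set is `{0, 1, 2, …}`. -/
abbrev EllTwo : Type := lp (fun _ : ℕ => ℂ) 2

namespace EllTwo

/-- The `(i, j)` entry of the matrix of `A`, that is `(A e_j)_i`. -/
def entry (A : EllTwo →L[ℂ] EllTwo) (i j : ℕ) : ℂ :=
  (A (lp.single 2 j (1 : ℂ)) : ℕ → ℂ) i

/-- The bandwidth of `A` is at most `b`. -/
def HasBandwidthLE (A : EllTwo →L[ℂ] EllTwo) (b : ℕ) : Prop :=
  ∀ i j : ℕ, (b : ℤ) < |(i : ℤ) - (j : ℤ)| → entry A i j = 0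

/-- A bounded operator on `ℓ²(ℕ)` is a band operator if its matrix is supported on finitely many
diagonals. -/
def IsBandOperator (A : EllTwo →L[ℂ] EllTwo) : Prop :=
  ∃ b : ℕ, HasBandwidthLE A b

/-- The block in position `(i, j)`, when the matrix of `A` is partitioned into `m × m` blocks. -/
def block (m : ℕ) (A : EllTwo →L[ℂ] EllTwo) (i j : ℕ) : Matrix (Fin m) (Fin m) ℂ :=
  Matrix.of fun p q => entry A (i * m + p) (j * m + q)

/-- `A` is block-tridiagonal when partitioned into `m × m` blocks. -/
def IsBlockTridiagonal (m : ℕ) (A : EllTwo →L[ℂ] EllTwo) : Prop :=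
  ∀ i j : ℕ, 1 < |(i : ℤ) - (j : ℤ)| → block m A i j = 0

/-- An operator of bandwidth at most `b` is block-tridiagonal for every block size `m ≥ b`; in
particular for `m = b + 1`, and for `m = 1` if `b = 1`. -/
theorem HasBandwidthLE.isBlockTridiagonal {A : EllTwo →L[ℂ] EllTwo} {b m : ℕ}
    (hA : HasBandwidthLE A b) (hbm : b ≤ m) : IsBlockTridiagonal m A := by
  intro i j hij
  ext p q
  apply hA
  have hp := p.isLt
  have hq := q.isLt
  push_cast
  rcases lt_abs.1 hij with h | h
  · have h2 : (2 : ℤ) ≤ (i : ℤ) - j := by linarith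
    refine lt_abs.2 (Or.inl ?_)
    nlinarith
  · have h2 : (2 : ℤ) ≤ (j : ℤ) - i := by linarith
    refine lt_abs.2 (Or.inr ?_)
    nlinarith

/-- The operator norm of a matrix acting on the Euclidean space `ℂᵐ`. -/
def matNorm {m : ℕ} (M : Matrix (Fin m) (Fin m) ℂ) : ℝ :=
  ‖Matrix.toEuclideanCLM (n := Fin m) (𝕜 := ℂ) M‖

/-- `‖α‖_∞`, where `α` is the block subdiagonal of `A`. -/
def subdiagNorm (m : ℕ) (A : EllTwo →L[ℂ] EllTwo) : ℝ :=
  ⨆ i : ℕ, matNorm (block m A (i + 1) i)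

/-- `‖γ‖_∞`, where `γ` is the block superdiagonal of `A`. -/
def superdiagNorm (m : ℕ) (A : EllTwo →L[ℂ] EllTwo) : ℝ :=
  ⨆ i : ℕ, matNorm (block m A i (i + 1))

/-- `ε_n = 2 (‖α‖_∞ + ‖γ‖_∞) sin (π / (2 (n + 1)))`, for the partition of `A` into `m × m`
blocks. -/
def epsN (m : ℕ) (A : EllTwo →L[ℂ] EllTwo) (n : ℕ) : ℝ :=
  2 * (subdiagNorm m A + superdiagNorm m A) * Real.sin (Real.pi / (2 * ((n : ℝ) + 1)))

/-- The Banach space adjoint of `A`, where the dual of `ℓ²(ℕ)` is identified with `ℓ²(ℕ)` by the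
bilinear pairing `∑ i, x i * y i`. Its matrix is the transpose (without complex conjugation) of
that of `A`; it is obtained here from the Hilbert space adjoint by conjugating entrywise. -/
def transpose (A : EllTwo →L[ℂ] EllTwo) : EllTwo →L[ℂ] EllTwo :=
  ((starₗᵢ ℂ : EllTwo ≃ₗᵢ⋆[ℂ] EllTwo) : EllTwo →L⋆[ℂ] EllTwo).comp
    ((ContinuousLinearMap.adjoint A).comp
      ((starₗᵢ ℂ : EllTwo ≃ₗᵢ⋆[ℂ] EllTwo) : EllTwo →L⋆[ℂ] EllTwo))

theorem transpose_apply (A : EllTwo →L[ℂ] EllTwo) (x : EllTwo) :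
    transpose A x = star (ContinuousLinearMap.adjoint A (star x)) := rfl

theorem entry_transpose (A : EllTwo →L[ℂ] EllTwo) (i j : ℕ) :
    entry (transpose A) i j = entry A j i := by
  have hstar : star (lp.single 2 j (1 : ℂ) : EllTwo) = lp.single 2 j (1 : ℂ) := by
    ext l
    rw [lp.star_apply]
    by_cases h : l = j
    · subst h
      rw [lp.single_apply_self, star_one]
    · rw [lp.single_apply_ne _ _ _ h, star_zero]
  have h1 := lp.inner_single_left (𝕜 := ℂ) (G := fun _ : ℕ => ℂ) i (1 : ℂ)
    (ContinuousLinearMap.adjoint A (lp.single 2 j (1 : ℂ)))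
  have h2 := lp.inner_single_right (𝕜 := ℂ) (G := fun _ : ℕ => ℂ) j (1 : ℂ)
    (A (lp.single 2 i (1 : ℂ)))
  rw [ContinuousLinearMap.adjoint_inner_right, h2] at h1
  unfold entry
  rw [transpose_apply, lp.star_apply, hstar]
  simp only [RCLike.inner_apply, map_one, mul_one, one_mul] at h1
  rw [← h1]
  simp

/-- The lower norm `ν(T) = inf {‖T x‖ : ‖x‖ = 1}`. -/
def lowerNorm {E F : Type*} [NormedAddCommGroup E] [NormedSpace ℂ E]
    [NormedAddCommGroup F] [NormedSpace ℂ F] (T : E →L[ℂ] F) : ℝ :=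
  ⨅ x : {x : E // ‖x‖ = 1}, ‖T x‖

/-- The pseudospectrum `spec_ε A = {z : ‖(A - z I)⁻¹‖ > 1 / ε}`, where `‖(A - z I)⁻¹‖` is
understood as `∞` if `A - z I` is not invertible. -/
def pseudospectrum (ε : ℝ) (A : EllTwo →L[ℂ] EllTwo) : Set ℂ :=
  {z | ¬ IsUnit (A - z • (1 : EllTwo →L[ℂ] EllTwo)) ∨
    1 / ε < ‖Ring.inverse (A - z • (1 : EllTwo →L[ℂ] EllTwo))‖}

/-- The subspace of the sequences supported in the `n` consecutive blocks (of length `m`) with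
numbers `k, …, k + n - 1`, counted from `0`. -/
def window (m n k : ℕ) : Submodule ℂ EllTwo where
  carrier := {x | ∀ j : ℕ, ¬ (k * m ≤ j ∧ j < (k + n) * m) → (x : ℕ → ℂ) j = 0}
  zero_mem' := fun _ _ => rfl
  add_mem' := fun {x y} hx hy j hj => by
    rw [lp.coeFn_add, Pi.add_apply, hx j hj, hy j hj, add_zero]
  smul_mem' := fun c x hx j hj => by
    rw [lp.coeFn_smul, Pi.smul_apply, hx j hj, smul_zero]

/-- The pseudospectrum `spec_ε (A P_{n,k})` of the rectangular matrix formed by the `n` block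
columns of `A` with numbers `k, …, k + n - 1`: the set of `z` for which the lower norm (smallest
singular value) of the restriction of `A - z I` to the vectors supported in these columns is
less than `ε`. -/
def windowPseudospectrum (ε : ℝ) (A : EllTwo →L[ℂ] EllTwo) (m n k : ℕ) : Set ℂ :=
  {z | lowerNorm ((A - z • (1 : EllTwo →L[ℂ] EllTwo)).comp (window m n k).subtypeL) < ε}

/-- The union over `k` of `spec_ε (A P_{n,k}, A* P_{n,k})`, which is
`spec_ε (A P_{n,k}) ∪ spec_ε (A* P_{n,k})`. -/
def unionPseudospectrum (ε : ℝ) (A : EllTwo →L[ℂ] EllTwo) (m n : ℕ) : Set ℂ :=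
  ⋃ k : ℕ, (windowPseudospectrum ε A m n k ∪ windowPseudospectrum ε (transpose A) m n k)

end EllTwo

end

noncomputable section

namespace EllTwo

open ContinuousLinearMap

/-! The norm of the resolvent is governed by two lower norms: `z` lies in the `ε`-pseudospectrum iff
`A - z` or its transpose fails to be bounded below by `ε` (`mem_pseudospectrum_iff`). Passing to a
window can only raise a lower norm, which gives the first inclusion.

For the second, let `‖(A - z) x‖ < ε ‖x‖` and multiply the blocks of `x` by every integer translate
of a sine bump `w` living on `n` blocks. With `S = ∑ w²`, the squared norms of the truncations `y k`
sum to `S ‖x‖²`. The commutator of `A` with such a multiplication involves only the off-diagonal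
blocks and differences of neighbouring weights, whose squares sum to `(2 sin (π / (2 (n + 1))))² S`.
A weighted Cauchy–Schwarz inequality then bounds `∑ ‖(A - z) y k‖²` strictly below `(ε + ε_n)² S
‖x‖²`, so some `y k` works (`exists_window_of_mem_approxPointPseudospectrum`).

Since `ε_n → 0`, Hausdorff convergence reduces to continuity of the pseudospectrum in `ε`
(`exists_near_pseudospectrum`). This could fail only if the resolvent norm were nearly constant on a
disc; `sq_mul_le_of_lower_bounds` excludes that by averaging over fourth roots of unity. -/

/-! ### Transpose and invertibility -/

theorem transpose_sub_smul_one_apply (A : EllTwo →L[ℂ] EllTwo) (z : ℂ) (x : EllTwo) :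
    transpose (A - z • (1 : EllTwo →L[ℂ] EllTwo)) x = transpose A x - z • x := by
  have h1 : adjoint (1 : EllTwo →L[ℂ] EllTwo) = 1 := by
    rw [← star_eq_adjoint, star_one]
  rw [transpose_apply, transpose_apply, map_sub, map_smulₛₗ, h1, sub_apply, smul_apply, star_sub,
    star_smul, starRingEnd_apply, star_star]
  congr 2
  exact star_star x

theorem transpose_transpose (A : EllTwo →L[ℂ] EllTwo) : transpose (transpose A) = A := by
  ext1 x
  refine ext_inner_left ℂ fun y => ?_
  -- Both sides are the conjugate of the symmetric bilinear pairing `∑ u i * v i`.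
  have key : ∀ u v : EllTwo, inner ℂ u (star v) = inner ℂ v (star u) := by
    intro u v
    rw [lp.inner_eq_tsum, lp.inner_eq_tsum]
    refine tsum_congr fun i => ?_
    simp [RCLike.inner_apply, mul_comm]
  rw [transpose_apply, key, adjoint_inner_left, transpose_apply, key, star_star, star_star,
    adjoint_inner_left]

theorem norm_transpose_apply (A : EllTwo →L[ℂ] EllTwo) (x : EllTwo) :
    ‖transpose A x‖ = ‖adjoint A (star x)‖ := by
  rw [transpose_apply, norm_star]

/-- The bound on `T` gives injectivity and closed range; the bound on the transpose makes the
adjoint injective, hence the range dense. -/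
theorem isUnit_of_lower_bounds {T : EllTwo →L[ℂ] EllTwo} {c : ℝ} (hc : 0 < c)
    (h : ∀ x, c * ‖x‖ ≤ ‖T x‖) (ht : ∀ x, c * ‖x‖ ≤ ‖transpose T x‖) : IsUnit T := by
  rw [ContinuousLinearMap.isUnit_iff_bijective]
  have hanti : AntilipschitzWith (Real.toNNReal c⁻¹) T := by
    refine T.antilipschitz_of_bound fun x => ?_
    rw [Real.coe_toNNReal _ (inv_nonneg.2 hc.le), inv_mul_eq_div, le_div_iff₀ hc, mul_comm]
    exact h x
  refine ⟨hanti.injective, ?_⟩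
  have hclosed : IsClosed (Set.range T) := hanti.isClosed_range T.uniformContinuous
  have hker : (adjoint T).ker = ⊥ := by
    rw [LinearMap.ker_eq_bot']
    intro y hy
    have hy' : adjoint T y = 0 := hy
    have := ht (star y)
    rw [norm_transpose_apply, star_star, hy', norm_zero, norm_star] at this
    exact norm_le_zero_iff.1 (nonpos_of_mul_nonpos_right this hc)
  have hdense : T.range.topologicalClosure = ⊤ := by
    rw [Submodule.topologicalClosure_eq_top_iff, orthogonal_range, hker]
  rw [← Set.range_eq_univ]
  have hcoe : ((T.range : Submodule ℂ EllTwo) : Set EllTwo) = Set.range T := by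
    ext; simp
  rw [← hclosed.closure_eq, ← hcoe, ← Submodule.topologicalClosure_coe, hdense]
  rfl

/-! ### Pseudospectra through lower bounds -/

/-- The points `z` for which `A - z` is not bounded below by `ε`. -/
def approxPointPseudospectrum (ε : ℝ) (A : EllTwo →L[ℂ] EllTwo) : Set ℂ :=
  {z | ∃ x, ‖A x - z • x‖ < ε * ‖x‖}

theorem approxPointPseudospectrum_mono {ε η : ℝ} (h : ε ≤ η) (A : EllTwo →L[ℂ] EllTwo) :
    approxPointPseudospectrum ε A ⊆ approxPointPseudospectrum η A := by
  rintro z ⟨x, hx⟩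
  exact ⟨x, hx.trans_le (mul_le_mul_of_nonneg_right h (norm_nonneg x))⟩

theorem sub_smul_one_apply (A : EllTwo →L[ℂ] EllTwo) (z : ℂ) (x : EllTwo) :
    (A - z • (1 : EllTwo →L[ℂ] EllTwo)) x = A x - z • x := rfl

theorem isUnit_sub_smul_one {A : EllTwo →L[ℂ] EllTwo} {z : ℂ} {c : ℝ} (hc : 0 < c)
    (h : z ∉ approxPointPseudospectrum c A)
    (ht : z ∉ approxPointPseudospectrum c (transpose A)) :
    IsUnit (A - z • (1 : EllTwo →L[ℂ] EllTwo)) := by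
  refine isUnit_of_lower_bounds hc (fun x => ?_) (fun x => ?_)
  · exact not_lt.1 fun hx => h ⟨x, hx⟩
  · rw [transpose_sub_smul_one_apply]
    exact not_lt.1 fun hx => ht ⟨x, hx⟩

/-- Lower bounds by `ε` on `A - z` and its transpose give an inverse of norm at most `1 / ε`.
Conversely, a single vector violating one of them forces the inverse, or its adjoint of equal norm,
above `1 / ε`. -/
theorem mem_pseudospectrum_iff {A : EllTwo →L[ℂ] EllTwo} {ε : ℝ} (hε : 0 < ε) {z : ℂ} :
    z ∈ pseudospectrum ε A ↔
      z ∈ approxPointPseudospectrum ε A ∨ z ∈ approxPointPseudospectrum ε (transpose A) := by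
  have hpos : ∀ {c t s : ℝ}, 0 ≤ s → 0 ≤ t → s < ε * c → c ≤ t * s → 1 / ε < t := by
    intro c t s hs ht h1 h2
    have hc : 0 < c := pos_of_mul_pos_right (hs.trans_lt h1) hε.le
    have htp : 0 < t := pos_of_mul_pos_left (hc.trans_le h2) hs
    rw [div_lt_iff₀ hε]
    refine lt_of_mul_lt_mul_right (a := c) ?_ hc.le
    linarith [mul_lt_mul_of_pos_left h1 htp]
  constructor
  · intro hz
    by_contra hcon
    rw [not_or] at hcon
    have hu := isUnit_sub_smul_one hε hcon.1 hcon.2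
    rcases hz with hz | hz
    · exact hz hu
    · refine absurd hz (not_lt.2 (opNorm_le_bound _ (by positivity) fun y => ?_))
      set x := Ring.inverse (A - z • (1 : EllTwo →L[ℂ] EllTwo)) y with hx
      have hxy : A x - z • x = y := by
        have := congrArg (fun S : EllTwo →L[ℂ] EllTwo => S y) (Ring.mul_inverse_cancel _ hu)
        exact this
      have h1 := not_lt.1 fun h => hcon.1 ⟨x, h⟩
      rw [hxy] at h1
      rw [div_mul_eq_mul_div, one_mul, le_div_iff₀ hε, mul_comm]
      exact h1
  · intro hz
    by_cases hu : IsUnit (A - z • (1 : EllTwo →L[ℂ] EllTwo))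
    · refine Or.inr ?_
      rcases hz with ⟨x, hx⟩ | ⟨x, hx⟩
      · refine hpos (norm_nonneg _) (norm_nonneg _) hx ?_
        have := congrArg (fun S : EllTwo →L[ℂ] EllTwo => S x) (Ring.inverse_mul_cancel _ hu)
        calc ‖x‖ = ‖Ring.inverse (A - z • (1 : EllTwo →L[ℂ] EllTwo)) (A x - z • x)‖ :=
              congrArg norm this.symm
          _ ≤ _ := le_opNorm _ _
      · refine hpos (norm_nonneg _) (norm_nonneg _) hx ?_
        have h1 := congrArg star (Ring.mul_inverse_cancel _ hu)
        rw [star_mul, star_one] at h1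
        have h2 := congrArg (fun S : EllTwo →L[ℂ] EllTwo => S (star x)) h1
        rw [← transpose_sub_smul_one_apply, norm_transpose_apply, ← norm_star x,
          ← norm_star (Ring.inverse _)]
        calc ‖star x‖ = ‖star (Ring.inverse (A - z • (1 : EllTwo →L[ℂ] EllTwo)))
                (adjoint (A - z • (1 : EllTwo →L[ℂ] EllTwo)) (star x))‖ :=
              congrArg norm h2.symm
          _ ≤ _ := le_opNorm _ _
    · exact Or.inl hu

/-- Replaces the infimum by one vector. Positivity of `m` and `n` makes the unit sphere of the
window nonempty; over an empty index the real infimum would be `0`. -/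
theorem mem_windowPseudospectrum_iff {A : EllTwo →L[ℂ] EllTwo} {ε : ℝ} {m n k : ℕ}
    (hm : 0 < m) (hn : 0 < n) {z : ℂ} :
    z ∈ windowPseudospectrum ε A m n k ↔ ∃ x ∈ window m n k, ‖A x - z • x‖ < ε * ‖x‖ := by
  have hne : Nonempty {x : window m n k // ‖x‖ = 1} := by
    refine ⟨⟨⟨lp.single 2 (k * m) (1 : ℂ), fun j hj => ?_⟩, ?_⟩⟩
    · refine lp.single_apply_ne _ _ _ fun h => hj ?_
      subst h
      exact ⟨le_rfl, Nat.mul_lt_mul_of_pos_right (by omega) hm⟩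
    · rw [Submodule.coe_norm, lp.norm_single (by norm_num), norm_one]
  constructor
  · intro hz
    obtain ⟨⟨⟨x, hxw⟩, hx1⟩, hx⟩ := exists_lt_of_ciInf_lt (show lowerNorm _ < ε from hz)
    refine ⟨x, hxw, ?_⟩
    have hx1' : ‖x‖ = 1 := hx1
    rw [hx1', mul_one]
    exact hx
  · rintro ⟨x, hxw, hx⟩
    have hx0 : 0 < ‖x‖ := by
      rcases (norm_nonneg x).eq_or_lt with h | h
      · rw [← h, mul_zero] at hx
        exact absurd hx (not_lt.2 (norm_nonneg _))
      · exact h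
    have hnorm : ‖((‖x‖⁻¹ : ℝ) : ℂ)‖ = ‖x‖⁻¹ := by simp
    let y : window m n k := ((‖x‖⁻¹ : ℝ) : ℂ) • ⟨x, hxw⟩
    have hy1 : ‖y‖ = 1 := by
      change ‖((‖x‖⁻¹ : ℝ) : ℂ) • x‖ = 1
      rw [norm_smul, hnorm, inv_mul_cancel₀ hx0.ne']
    change lowerNorm _ < ε
    refine (ciInf_le ⟨0, ?_⟩ (⟨y, hy1⟩ : {x : window m n k // ‖x‖ = 1})).trans_lt ?_
    · rintro _ ⟨w, rfl⟩
      exact norm_nonneg _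
    · change ‖A (((‖x‖⁻¹ : ℝ) : ℂ) • x) - z • (((‖x‖⁻¹ : ℝ) : ℂ) • x)‖ < ε
      rw [map_smul, smul_comm z, ← smul_sub, norm_smul, hnorm, inv_mul_lt_iff₀ hx0, mul_comm]
      exact hx

/-! ### Continuity of the pseudospectrum in `ε` -/

/-- The parallelogram law over the fourth roots of unity. -/
theorem sum_sq_norm_fourth_roots {E : Type*} [NormedAddCommGroup E] [InnerProductSpace ℂ E]
    (a b c d : E) :
    ‖a + b + c + d‖ ^ 2 + ‖a - b + c - d‖ ^ 2 +
      (‖a + Complex.I • b - c - Complex.I • d‖ ^ 2 +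
        ‖a - Complex.I • b - c + Complex.I • d‖ ^ 2) =
      4 * (‖a‖ ^ 2 + ‖b‖ ^ 2 + ‖c‖ ^ 2 + ‖d‖ ^ 2) := by
  have h1 := parallelogram_law_with_norm ℂ (a + c) (b + d)
  have h2 := parallelogram_law_with_norm ℂ (a - c) (Complex.I • (b - d))
  have h3 := parallelogram_law_with_norm ℂ a c
  have h4 := parallelogram_law_with_norm ℂ b d
  rw [norm_smul, Complex.norm_I, one_mul] at h2
  rw [show a + b + c + d = a + c + (b + d) by abel,
    show a - b + c - d = a + c - (b + d) by abel,
    show a + Complex.I • b - c - Complex.I • d = a - c + Complex.I • (b - d) by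
      rw [smul_sub]; abel,
    show a - Complex.I • b - c + Complex.I • d = a - c - Complex.I • (b - d) by
      rw [smul_sub]; abel]
  nlinarith

/-- A quantitative form of the fact that the norm of the resolvent of an operator on a Hilbert
space is not constant near a point. -/
theorem sq_mul_le_of_lower_bounds {E : Type*} [NormedAddCommGroup E] [InnerProductSpace ℂ E]
    (T : E →L[ℂ] E) (hT : Function.Surjective T) {c r ρ K : ℝ} (hc : 0 < c) (hρ : 0 ≤ ρ)
    (hρr : ρ ≤ r) (hK : 0 < K) (hTK : ∀ u, ‖T u‖ ≤ K * ‖u‖)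
    (h : ∀ μ : ℂ, ‖μ‖ ≤ r → ∀ u, c * ‖u‖ ≤ ‖T u - μ • u‖) (v : E) :
    c ^ 2 * (1 + ρ ^ 2 / K ^ 2) * ‖v‖ ^ 2 ≤ (‖T v‖ + ρ ^ 4 / c ^ 3 * ‖v‖) ^ 2 := by
  -- The vectors `z₁, z₂, z₃` play the role of `T⁻¹ v, T⁻² v, T⁻³ v`.
  obtain ⟨z₁, h₁⟩ := hT v
  obtain ⟨z₂, h₂⟩ := hT z₁
  obtain ⟨z₃, h₃⟩ := hT z₂
  have h0 : ∀ u, c * ‖u‖ ≤ ‖T u‖ := fun u => by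
    simpa using h 0 (by simpa using hρ.trans hρr) u
  have b1 := h0 z₁
  have b2 := h0 z₂
  have b3 := h0 z₃
  rw [h₁] at b1
  rw [h₂] at b2
  rw [h₃] at b3
  have hz3 : ‖z₃‖ ≤ ‖v‖ / c ^ 3 := by
    rw [le_div_iff₀ (by positivity)]
    nlinarith [mul_le_mul_of_nonneg_left b2 hc.le,
      mul_le_mul_of_nonneg_left b3 (sq_nonneg c)]
  have hz1 : ‖v‖ / K ≤ ‖z₁‖ := by
    rw [div_le_iff₀ hK, mul_comm, ← h₁]
    exact hTK z₁
  set x := T v - ((ρ : ℂ) ^ 4) • z₃ with hx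
  have hxn : ‖x‖ ≤ ‖T v‖ + ρ ^ 4 / c ^ 3 * ‖v‖ := by
    refine (norm_sub_le _ _).trans (add_le_add le_rfl ?_)
    rw [norm_smul, norm_pow, Complex.norm_real, Real.norm_of_nonneg hρ, div_mul_eq_mul_div,
      mul_div_assoc]
    exact mul_le_mul_of_nonneg_left hz3 (by positivity)
  -- With `μ = ω ρ`, applying `T - μ` to the truncated resolvent series telescopes to `T v - μ⁴ z₃`,
  -- and `μ⁴ = ρ⁴`: the image `x` is the same for all four roots.
  have key : ∀ ω : ℂ, ω ^ 4 = 1 →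
      c ^ 2 * ‖v + (ω * ρ) • z₁ + (ω * ρ) ^ 2 • z₂ + (ω * ρ) ^ 3 • z₃‖ ^ 2 ≤ ‖x‖ ^ 2 := by
    intro ω hω
    have hωn : ‖ω‖ = 1 := by
      have := congrArg norm hω
      rw [norm_pow, norm_one] at this
      exact (pow_eq_one_iff_of_nonneg (norm_nonneg _) (by norm_num)).1 this
    have hb := h (ω * ρ) (by
      rw [norm_mul, hωn, one_mul, Complex.norm_real, Real.norm_of_nonneg hρ]; exact hρr)
      (v + (ω * ρ) • z₁ + (ω * ρ) ^ 2 • z₂ + (ω * ρ) ^ 3 • z₃)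
    have he : T (v + (ω * ρ) • z₁ + (ω * ρ) ^ 2 • z₂ + (ω * ρ) ^ 3 • z₃) -
        (ω * ρ) • (v + (ω * ρ) • z₁ + (ω * ρ) ^ 2 • z₂ + (ω * ρ) ^ 3 • z₃) = x := by
      simp only [map_add, map_smul, h₁, h₂, h₃, hx]
      have : (ρ : ℂ) ^ 4 = (ω * ρ) ^ 4 := by rw [mul_pow, hω, one_mul]
      rw [this]
      module
    rw [he] at hb
    rw [← mul_pow]
    exact pow_le_pow_left₀ (by positivity) hb 2
  have k1 := key 1 (by norm_num)
  have k2 := key (-1) (by norm_num)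
  have k3 := key Complex.I Complex.I_pow_four
  have k4 := key (-Complex.I) (by rw [neg_pow, Complex.I_pow_four]; norm_num)
  have hsum := sum_sq_norm_fourth_roots v ((ρ : ℂ) • z₁) (((ρ : ℂ) ^ 2) • z₂)
    (((ρ : ℂ) ^ 3) • z₃)
  rw [show v + (1 * (ρ : ℂ)) • z₁ + (1 * (ρ : ℂ)) ^ 2 • z₂ + (1 * (ρ : ℂ)) ^ 3 • z₃ =
    v + (ρ : ℂ) • z₁ + ((ρ : ℂ) ^ 2) • z₂ + ((ρ : ℂ) ^ 3) • z₃ by module] at k1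
  rw [show v + (-1 * (ρ : ℂ)) • z₁ + (-1 * (ρ : ℂ)) ^ 2 • z₂ + (-1 * (ρ : ℂ)) ^ 3 • z₃ =
    v - (ρ : ℂ) • z₁ + ((ρ : ℂ) ^ 2) • z₂ - ((ρ : ℂ) ^ 3) • z₃ by module] at k2
  rw [show v + (Complex.I * (ρ : ℂ)) • z₁ + (Complex.I * (ρ : ℂ)) ^ 2 • z₂ +
      (Complex.I * (ρ : ℂ)) ^ 3 • z₃ =
    v + Complex.I • (ρ : ℂ) • z₁ - ((ρ : ℂ) ^ 2) • z₂ - Complex.I • ((ρ : ℂ) ^ 3) • z₃ by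
      rw [mul_pow, mul_pow, Complex.I_sq, Complex.I_pow_three]; module] at k3
  rw [show v + (-Complex.I * (ρ : ℂ)) • z₁ + (-Complex.I * (ρ : ℂ)) ^ 2 • z₂ +
      (-Complex.I * (ρ : ℂ)) ^ 3 • z₃ =
    v - Complex.I • (ρ : ℂ) • z₁ - ((ρ : ℂ) ^ 2) • z₂ + Complex.I • ((ρ : ℂ) ^ 3) • z₃ by
      rw [mul_pow, mul_pow, neg_sq, Complex.I_sq, neg_pow Complex.I 3, Complex.I_pow_three]
      module] at k4
  have hn1 : ‖(ρ : ℂ) • z₁‖ ^ 2 = ρ ^ 2 * ‖z₁‖ ^ 2 := by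
    rw [norm_smul, Complex.norm_real, Real.norm_of_nonneg hρ, mul_pow]
  rw [hn1] at hsum
  have hzz : ρ ^ 2 / K ^ 2 * ‖v‖ ^ 2 ≤ ρ ^ 2 * ‖z₁‖ ^ 2 := by
    rw [div_mul_eq_mul_div, mul_div_assoc, ← div_pow]
    exact mul_le_mul_of_nonneg_left (pow_le_pow_left₀ (by positivity) hz1 2) (by positivity)
  -- Averaging the four bounds leaves the sum of the squared norms of the coefficients; only those
  -- of `v` and `ρ z₁` are kept.
  have hfin : c ^ 2 * (‖v‖ ^ 2 + ρ ^ 2 * ‖z₁‖ ^ 2) ≤ ‖x‖ ^ 2 := by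
    have : 0 ≤ c ^ 2 * (‖((ρ : ℂ) ^ 2) • z₂‖ ^ 2 + ‖((ρ : ℂ) ^ 3) • z₃‖ ^ 2) := by positivity
    nlinarith [congrArg (fun t => c ^ 2 * t) hsum]
  calc c ^ 2 * (1 + ρ ^ 2 / K ^ 2) * ‖v‖ ^ 2
      = c ^ 2 * (‖v‖ ^ 2 + ρ ^ 2 / K ^ 2 * ‖v‖ ^ 2) := by ring
    _ ≤ c ^ 2 * (‖v‖ ^ 2 + ρ ^ 2 * ‖z₁‖ ^ 2) := by gcongr
    _ ≤ ‖x‖ ^ 2 := hfin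
    _ ≤ _ := pow_le_pow_left₀ (norm_nonneg _) hxn 2

/-- The gain on the right is of order `ρ²`, the error on the left of order `ρ⁴`. So the inequality
holds at `δ = 0` for small `ρ`, and by continuity for small `δ > 0`. -/
theorem exists_radius_and_gap {ε K r : ℝ} (hε : 0 < ε) (hK : 0 < K) (hr : 0 < r) :
    ∃ ρ δ : ℝ, 0 < ρ ∧ ρ ≤ r ∧ 0 < δ ∧ δ < ε ∧
      (ε + δ + ρ ^ 4 / (ε - δ) ^ 3) ^ 2 < (ε - δ) ^ 2 * (1 + ρ ^ 2 / K ^ 2) := by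
  obtain ⟨ρ, hρ, hρr, h1⟩ : ∃ ρ : ℝ, 0 < ρ ∧ ρ ≤ r ∧
      2 * ρ ^ 2 / ε ^ 2 + ρ ^ 6 / ε ^ 6 < ε ^ 2 / K ^ 2 := by
    have hcont : ContinuousAt (fun ρ : ℝ => 2 * ρ ^ 2 / ε ^ 2 + ρ ^ 6 / ε ^ 6) 0 := by fun_prop
    have hev := hcont.eventually_lt_const (u := ε ^ 2 / K ^ 2) (by
      simp only [ne_eq, OfNat.ofNat_ne_zero, not_false_eq_true, zero_pow, mul_zero, zero_div,
        add_zero]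
      positivity)
    have hev' := (hev.filter_mono nhdsWithin_le_nhds).and
      (Ioc_mem_nhdsGT hr : Set.Ioc 0 r ∈ 𝓝[>] (0 : ℝ))
    obtain ⟨ρ, h, hρ⟩ := hev'.exists
    exact ⟨ρ, hρ.1, hρ.2, h⟩
  have h2 : (ε + 0 + ρ ^ 4 / (ε - 0) ^ 3) ^ 2 < (ε - 0) ^ 2 * (1 + ρ ^ 2 / K ^ 2) := by
    rw [add_zero, sub_zero]
    have e1 : (ε + ρ ^ 4 / ε ^ 3) ^ 2 = ε ^ 2 + ρ ^ 2 * (2 * ρ ^ 2 / ε ^ 2 + ρ ^ 6 / ε ^ 6) := by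
      field_simp
      ring
    have e2 : ε ^ 2 * (1 + ρ ^ 2 / K ^ 2) = ε ^ 2 + ρ ^ 2 * (ε ^ 2 / K ^ 2) := by ring
    rw [e1, e2]
    have := mul_lt_mul_of_pos_left h1 (pow_pos hρ 2)
    linarith
  have hc1 : ContinuousAt (fun δ : ℝ => (ε + δ + ρ ^ 4 / (ε - δ) ^ 3) ^ 2) 0 := by
    refine ((continuousAt_const.add continuousAt_id).add
      (continuousAt_const.div (by fun_prop) ?_)).pow 2
    rw [sub_zero]
    positivity
  have hc2 : ContinuousAt (fun δ : ℝ => (ε - δ) ^ 2 * (1 + ρ ^ 2 / K ^ 2)) 0 := by fun_prop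
  have hev := ((hc1.eventually_lt hc2 h2).filter_mono nhdsWithin_le_nhds).and
    (Ioo_mem_nhdsGT hε : Set.Ioo 0 ε ∈ 𝓝[>] (0 : ℝ))
  obtain ⟨δ, h, hδ⟩ := hev.exists
  exact ⟨ρ, δ, hρ, hρr, hδ.1, hδ.2, h⟩

/-- If the closed disc of radius `r` about `z` avoided both sets at level `ε - δ`, the averaging
inequality would contradict the gap between `ε + δ` and `ε - δ`. Here `δ` depends on `A` only
through the bound `L`, so one `δ` serves an operator and its transpose. -/
theorem exists_near_approxPointPseudospectrum {ε L r : ℝ} (hε : 0 < ε) (hL : 0 ≤ L)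
    (hr : 0 < r) :
    ∃ δ, 0 < δ ∧ δ < ε ∧ ∀ A : EllTwo →L[ℂ] EllTwo, ‖A‖ ≤ L →
      ∀ z ∈ approxPointPseudospectrum (ε + δ) A, ∃ w, dist z w ≤ r ∧
        (w ∈ approxPointPseudospectrum (ε - δ) A ∨
          w ∈ approxPointPseudospectrum (ε - δ) (transpose A)) := by
  -- `2 (L + ε)` bounds `‖A‖ + ‖z‖`, because `δ < ε` forces `‖z‖ ≤ L + 2 ε`.
  obtain ⟨ρ, δ, hρ, hρr, hδ, hδε, hlt⟩ :=
    exists_radius_and_gap hε (show 0 < 2 * (L + ε) by positivity) hr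
  refine ⟨δ, hδ, hδε, fun A hA z hz => ?_⟩
  obtain ⟨v, hv⟩ := hz
  by_contra! hcon
  have hc : 0 < ε - δ := sub_pos.2 hδε
  have hv0 : 0 < ‖v‖ := by
    rcases (norm_nonneg v).eq_or_lt with h | h
    · rw [← h, mul_zero] at hv
      exact absurd hv (not_lt.2 (norm_nonneg _))
    · exact h
  have hAv : ∀ u, ‖A u‖ ≤ L * ‖u‖ := fun u =>
    (A.le_opNorm u).trans (mul_le_mul_of_nonneg_right hA (norm_nonneg u))
  have hz : ‖z‖ ≤ L + 2 * ε := by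
    have h1 : ‖z‖ * ‖v‖ ≤ (L + 2 * ε) * ‖v‖ := by
      have h2 := norm_sub_norm_le (z • v) (A v)
      rw [norm_smul, norm_sub_rev] at h2
      nlinarith [hAv v, mul_lt_mul_of_pos_right hδε hv0]
    exact le_of_mul_le_mul_right h1 hv0
  obtain ⟨hz1, hz2⟩ := hcon z (by rw [dist_self]; exact hr.le)
  have hu := isUnit_sub_smul_one hc hz1 hz2
  have hsurj := (ContinuousLinearMap.isUnit_iff_bijective.1 hu).2
  have hmain := sq_mul_le_of_lower_bounds (A - z • (1 : EllTwo →L[ℂ] EllTwo)) hsurj hc hρ.le hρr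
    (show 0 < 2 * (L + ε) by positivity) (fun u => ?_) (fun μ hμ u => ?_) v
  · rw [sub_smul_one_apply] at hmain
    have h3 : (‖A v - z • v‖ + ρ ^ 4 / (ε - δ) ^ 3 * ‖v‖) ^ 2 ≤
        (ε + δ + ρ ^ 4 / (ε - δ) ^ 3) ^ 2 * ‖v‖ ^ 2 := by
      rw [← mul_pow]
      refine pow_le_pow_left₀ (by positivity) ?_ 2
      rw [add_mul (ε + δ)]
      linarith
    have h4 := mul_lt_mul_of_pos_right hlt (pow_pos hv0 2)
    linarith
  · rw [sub_smul_one_apply]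
    refine (norm_sub_le _ _).trans ?_
    rw [norm_smul]
    nlinarith [hAv u, mul_le_mul_of_nonneg_right hz (norm_nonneg u)]
  · have h5 := (hcon (z + μ) (by rw [dist_self_add_right]; exact hμ)).1
    have h6 := not_lt.1 fun hx => h5 ⟨u, hx⟩
    rwa [sub_smul_one_apply, sub_sub, ← add_smul]

/-- On `ℓ²(ℕ)`, the pseudospectra depend continuously on their parameter. -/
theorem exists_near_pseudospectrum (A : EllTwo →L[ℂ] EllTwo) {ε r : ℝ} (hε : 0 < ε)
    (hr : 0 < r) :
    ∃ δ, 0 < δ ∧ δ < ε ∧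
      ∀ z ∈ pseudospectrum (ε + δ) A, ∃ w ∈ pseudospectrum (ε - δ) A, dist z w ≤ r := by
  obtain ⟨δ, hδ, hδε, h⟩ := exists_near_approxPointPseudospectrum
    (L := max ‖A‖ ‖transpose A‖) hε ((norm_nonneg A).trans (le_max_left _ _)) hr
  refine ⟨δ, hδ, hδε, fun z hz => ?_⟩
  rcases (mem_pseudospectrum_iff (by positivity)).1 hz with hz | hz
  · obtain ⟨w, hw, hw'⟩ := h A (le_max_left _ _) z hz
    exact ⟨w, (mem_pseudospectrum_iff (sub_pos.2 hδε)).2 hw', hw⟩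
  · obtain ⟨w, hw, hw'⟩ := h (transpose A) (le_max_right _ _) z hz
    rw [transpose_transpose] at hw'
    exact ⟨w, (mem_pseudospectrum_iff (sub_pos.2 hδε)).2 hw'.symm, hw⟩

theorem pseudospectrum_mono {ε η : ℝ} (hε : 0 < ε) (h : ε ≤ η) (A : EllTwo →L[ℂ] EllTwo) :
    pseudospectrum ε A ⊆ pseudospectrum η A := fun _ hz =>
  (mem_pseudospectrum_iff (hε.trans_le h)).2 <| ((mem_pseudospectrum_iff hε).1 hz).imp
    (fun hz => approxPointPseudospectrum_mono h A hz)
    (fun hz => approxPointPseudospectrum_mono h _ hz)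

/-! ### Block decomposition of vectors and operators -/

/-- The `i`-th block of length `m` of a sequence. -/
def blockVec (m : ℕ) (x : EllTwo) (i : ℕ) : EuclideanSpace ℂ (Fin m) :=
  WithLp.toLp 2 fun p => (x : ℕ → ℂ) (i * m + p)

theorem blockVec_apply (m : ℕ) (x : EllTwo) (i : ℕ) (p : Fin m) :
    blockVec m x i p = (x : ℕ → ℂ) (i * m + p) := rfl

theorem blockVec_sub (m : ℕ) (x y : EllTwo) (i : ℕ) :
    blockVec m (x - y) i = blockVec m x i - blockVec m y i := rfl

theorem blockVec_smul (m : ℕ) (c : ℂ) (x : EllTwo) (i : ℕ) :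
    blockVec m (c • x) i = c • blockVec m x i := rfl

theorem hasSum_blocks {E : Type*} [NormedAddCommGroup E] {m : ℕ} (hm : 0 < m) {f : ℕ → E}
    {s : E} (hf : HasSum f s) : HasSum (fun i => ∑ p : Fin m, f (i * m + p)) s := by
  have : NeZero m := ⟨hm.ne'⟩
  have h := (Nat.divModEquiv m).symm.hasSum_iff.2 hf
  refine h.prod_fiberwise fun i => ?_
  simp only [Function.comp_apply, Nat.divModEquiv_symm_apply]
  exact hasSum_fintype _

theorem hasSum_sq_norm (x : EllTwo) : HasSum (fun j => ‖(x : ℕ → ℂ) j‖ ^ 2) (‖x‖ ^ 2) := by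
  simpa using lp.hasSum_norm (p := 2) (by norm_num) x

theorem hasSum_sq_norm_blockVec {m : ℕ} (hm : 0 < m) (x : EllTwo) :
    HasSum (fun i => ‖blockVec m x i‖ ^ 2) (‖x‖ ^ 2) := by
  simpa only [EuclideanSpace.norm_sq_eq, blockVec_apply] using hasSum_blocks hm (hasSum_sq_norm x)

theorem norm_blockVec_le {m : ℕ} (hm : 0 < m) (x : EllTwo) (i : ℕ) : ‖blockVec m x i‖ ≤ ‖x‖ :=
  le_of_sq_le_sq (le_hasSum (hasSum_sq_norm_blockVec hm x) i fun _ _ => sq_nonneg _)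
    (norm_nonneg x)

theorem hasSum_entry_mul (A : EllTwo →L[ℂ] EllTwo) (x : EllTwo) (i : ℕ) :
    HasSum (fun j => entry A i j * (x : ℕ → ℂ) j) ((A x : ℕ → ℂ) i) := by
  have hs : ∀ j, lp.evalCLM ℂ (fun _ : ℕ => ℂ) 2 i (A (lp.single 2 j ((x : ℕ → ℂ) j))) =
      entry A i j * (x : ℕ → ℂ) j := fun j => by
    have : (lp.single 2 j ((x : ℕ → ℂ) j) : EllTwo) =
        (x : ℕ → ℂ) j • lp.single 2 j (1 : ℂ) := by
      rw [← lp.single_smul, smul_eq_mul, mul_one]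
    rw [this, map_smul, map_smul, smul_eq_mul, mul_comm]
    rfl
  have h := ((lp.hasSum_single (p := 2) (by norm_num) x).mapL A).mapL
    (lp.evalCLM ℂ (fun _ : ℕ => ℂ) 2 i)
  simp only [hs] at h
  exact h

/-- The operator on `ℂᵐ` given by a block of `A`. -/
def blockCLM (m : ℕ) (A : EllTwo →L[ℂ] EllTwo) (i j : ℕ) :
    EuclideanSpace ℂ (Fin m) →L[ℂ] EuclideanSpace ℂ (Fin m) :=
  Matrix.toEuclideanCLM (n := Fin m) (𝕜 := ℂ) (block m A i j)

theorem hasSum_blockCLM {m : ℕ} (hm : 0 < m) (A : EllTwo →L[ℂ] EllTwo) (x : EllTwo) (i : ℕ) :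
    HasSum (fun j => blockCLM m A i j (blockVec m x j)) (blockVec m (A x) i) := by
  have h : HasSum (fun j => (block m A i j).mulVec (blockVec m x j).ofLp)
      (blockVec m (A x) i).ofLp := by
    rw [Pi.hasSum]
    intro p
    have hp := hasSum_blocks hm (hasSum_entry_mul A x (i * m + p))
    simpa only [Matrix.mulVec, dotProduct, block, Matrix.of_apply, EllTwo.blockVec_apply] using hp
  have h2 := h.mapL (EuclideanSpace.equiv (Fin m) ℂ).symm.toContinuousLinearMap
  have h3 : ∀ j, (EuclideanSpace.equiv (Fin m) ℂ).symm.toContinuousLinearMap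
      ((block m A i j).mulVec (blockVec m x j).ofLp) = blockCLM m A i j (blockVec m x j) :=
    fun j => (Matrix.toEuclideanCLM_toLp _ _).symm
  simp only [h3] at h2
  exact h2

theorem exists_blockVec_eq {m : ℕ} (hm : 0 < m) (j : ℕ) (v : EuclideanSpace ℂ (Fin m)) :
    ∃ x : EllTwo, blockVec m x j = v ∧ ∀ i, i ≠ j → blockVec m x i = 0 := by
  have : NeZero m := ⟨hm.ne'⟩
  let f : ℕ → ℂ := fun l => if l / m = j then v (Fin.ofNat m l) else 0
  have hf : Memℓp f 2 := by
    refine (memℓp_zero ((Set.finite_lt_nat ((j + 1) * m)).subset fun l hl => ?_)).of_exponent_ge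
      zero_le
    have : l / m = j := by
      by_contra h
      exact hl (if_neg h)
    exact (Nat.div_lt_iff_lt_mul hm).1 (by omega)
  have hdiv : ∀ (i : ℕ) (p : Fin m), (i * m + p) / m = i := fun i p => by
    rw [Nat.mul_comm, Nat.mul_add_div hm, Nat.div_eq_of_lt p.2, add_zero]
  have hval : ∀ (i : ℕ) (p : Fin m), f (i * m + p) = if i = j then v p else 0 := fun i p => by
    have : Fin.ofNat m (i * m + p) = p := by
      ext
      simp [Fin.ofNat, Nat.mod_eq_of_lt p.2]
    simp only [f, hdiv, this]
  refine ⟨⟨f, hf⟩, ?_, fun i hi => ?_⟩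
  · ext p
    exact (hval j p).trans (if_pos rfl)
  · ext p
    exact (hval i p).trans (if_neg hi)

/-- Extend a vector of `ℂᵐ` by zero to a sequence of equal norm. This bounds the families defining
`‖α‖_∞` and `‖γ‖_∞`; an unbounded real supremum would take the default value `0`. -/
theorem norm_blockCLM_le {m : ℕ} (hm : 0 < m) (A : EllTwo →L[ℂ] EllTwo) (i j : ℕ) :
    ‖blockCLM m A i j‖ ≤ ‖A‖ := by
  refine opNorm_le_bound _ (norm_nonneg A) fun v => ?_
  obtain ⟨x, hx, hx0⟩ := exists_blockVec_eq hm j v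
  have h1 : blockCLM m A i j v = blockVec m (A x) i := by
    have h2 := hasSum_single (f := fun l => blockCLM m A i l (blockVec m x l)) j
      (fun l hl => by rw [hx0 l hl, map_zero])
    rw [hx] at h2
    exact h2.unique (hasSum_blockCLM hm A x i)
  have h3 : ‖x‖ = ‖v‖ := by
    have h4 := hasSum_single (f := fun l => ‖blockVec m x l‖ ^ 2) j
      (fun l hl => by rw [hx0 l hl, norm_zero]; norm_num)
    rw [hx] at h4
    exact ((sq_eq_sq₀ (norm_nonneg _) (norm_nonneg _)).1
      (h4.unique (hasSum_sq_norm_blockVec hm x))).symm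
  rw [h1, ← h3]
  exact (norm_blockVec_le hm _ i).trans (A.le_opNorm x)

theorem norm_blockCLM_le_subdiagNorm {m : ℕ} (hm : 0 < m) (A : EllTwo →L[ℂ] EllTwo) (i : ℕ) :
    ‖blockCLM m A (i + 1) i‖ ≤ subdiagNorm m A :=
  le_ciSup (f := fun i => matNorm (block m A (i + 1) i))
    ⟨‖A‖, by rintro _ ⟨j, rfl⟩; exact norm_blockCLM_le hm A (j + 1) j⟩ i

theorem norm_blockCLM_le_superdiagNorm {m : ℕ} (hm : 0 < m) (A : EllTwo →L[ℂ] EllTwo) (i : ℕ) :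
    ‖blockCLM m A i (i + 1)‖ ≤ superdiagNorm m A :=
  le_ciSup (f := fun i => matNorm (block m A i (i + 1)))
    ⟨‖A‖, by rintro _ ⟨j, rfl⟩; exact norm_blockCLM_le hm A j (j + 1)⟩ i

theorem block_transpose (m : ℕ) (A : EllTwo →L[ℂ] EllTwo) (i j : ℕ) :
    block m (transpose A) i j = (block m A j i).transpose := by
  ext p q
  exact entry_transpose A _ _

theorem norm_toLp_star {m : ℕ} (v : EuclideanSpace ℂ (Fin m)) :
    ‖(WithLp.toLp 2 (star v.ofLp) : EuclideanSpace ℂ (Fin m))‖ = ‖v‖ := by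
  simp [EuclideanSpace.norm_eq]

theorem matNorm_transpose {m : ℕ} (M : Matrix (Fin m) (Fin m) ℂ) :
    matNorm M.transpose = matNorm M := by
  have key : ∀ M : Matrix (Fin m) (Fin m) ℂ, matNorm M.transpose ≤ matNorm M := by
    intro M
    refine opNorm_le_bound _ (norm_nonneg _) fun v => ?_
    -- The transpose is the conjugate transpose conjugated entrywise on both sides, and entrywise
    -- conjugation is isometric.
    have h1 : Matrix.toEuclideanCLM (n := Fin m) (𝕜 := ℂ) M.transpose v =
        WithLp.toLp 2 (star (Matrix.toEuclideanCLM (n := Fin m) (𝕜 := ℂ) (star M)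
          (WithLp.toLp 2 (star v.ofLp))).ofLp) := by
      rw [Matrix.ofLp_toEuclideanCLM, Matrix.star_eq_conjTranspose, Matrix.star_mulVec,
        Matrix.conjTranspose_conjTranspose, star_star, ← Matrix.mulVec_transpose,
        ← Matrix.toEuclideanCLM_toLp]
    rw [h1, norm_toLp_star, map_star]
    refine (le_opNorm _ _).trans_eq ?_
    rw [norm_toLp_star]
    exact congrArg (· * ‖v‖) (norm_star (Matrix.toEuclideanCLM (n := Fin m) (𝕜 := ℂ) M))
  refine le_antisymm (key M) ?_
  simpa using key M.transpose

theorem subdiagNorm_transpose (m : ℕ) (A : EllTwo →L[ℂ] EllTwo) :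
    subdiagNorm m (transpose A) = superdiagNorm m A := by
  simp only [subdiagNorm, superdiagNorm, block_transpose, matNorm_transpose]

theorem superdiagNorm_transpose (m : ℕ) (A : EllTwo →L[ℂ] EllTwo) :
    superdiagNorm m (transpose A) = subdiagNorm m A := by
  simp only [subdiagNorm, superdiagNorm, block_transpose, matNorm_transpose]

/-- Transposition swaps the roles of `α` and `γ`, and `ε_n` is symmetric in them; hence the window
estimate applies to both operators with one constant. -/
theorem epsN_transpose (m : ℕ) (A : EllTwo →L[ℂ] EllTwo) (n : ℕ) :
    epsN m (transpose A) n = epsN m A n := by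
  rw [epsN, epsN, subdiagNorm_transpose, superdiagNorm_transpose, add_comm (subdiagNorm m A)]

theorem IsBlockTridiagonal.transpose {m : ℕ} {A : EllTwo →L[ℂ] EllTwo}
    (hA : IsBlockTridiagonal m A) : IsBlockTridiagonal m (transpose A) := fun i j hij => by
  rw [block_transpose, hA j i (by rwa [abs_sub_comm]), Matrix.transpose_zero]

/-- The contribution of the block subdiagonal to the blocks of `A x`. -/
def subdiagPart (m : ℕ) (A : EllTwo →L[ℂ] EllTwo) (x : EllTwo) : ℕ → EuclideanSpace ℂ (Fin m)
  | 0 => 0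
  | i + 1 => blockCLM m A (i + 1) i (blockVec m x i)

/-- The contribution of the block superdiagonal to the blocks of `A x`. -/
def superdiagPart (m : ℕ) (A : EllTwo →L[ℂ] EllTwo) (x : EllTwo) (i : ℕ) :
    EuclideanSpace ℂ (Fin m) :=
  blockCLM m A i (i + 1) (blockVec m x (i + 1))

theorem IsBlockTridiagonal.blockVec_apply {m : ℕ} (hm : 0 < m) {A : EllTwo →L[ℂ] EllTwo}
    (hA : IsBlockTridiagonal m A) (x : EllTwo) (i : ℕ) :
    blockVec m (A x) i =
      subdiagPart m A x i + blockCLM m A i i (blockVec m x i) + superdiagPart m A x i := by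
  have hzero : ∀ j : ℕ, 1 < |(i : ℤ) - (j : ℤ)| → blockCLM m A i j (blockVec m x j) = 0 := by
    intro j hj
    rw [blockCLM, hA i j hj, map_zero, zero_apply]
  have h := hasSum_blockCLM hm A x i
  rcases i with _ | i
  · have h' := hasSum_sum_of_ne_finset_zero (L := .unconditional ℕ) (s := {0, 1}) fun j hj =>
      hzero j (by
        simp only [Finset.mem_insert, Finset.mem_singleton] at hj
        rw [lt_abs]
        omega)
    rw [h.unique h', Finset.sum_pair (by norm_num), subdiagPart, zero_add]
    rfl
  · have h' := hasSum_sum_of_ne_finset_zero (L := .unconditional ℕ) (s := {i, i + 1, i + 2})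
      fun j hj => hzero j (by
        simp only [Finset.mem_insert, Finset.mem_singleton] at hj
        rw [lt_abs]
        omega)
    rw [h.unique h', Finset.sum_insert (by simp), Finset.sum_pair (by simp), ← add_assoc]
    rfl

theorem sq_norm_subdiagPart_le {m : ℕ} (hm : 0 < m) (A : EllTwo →L[ℂ] EllTwo) (x : EllTwo)
    (i : ℕ) :
    ‖subdiagPart m A x (i + 1)‖ ^ 2 ≤ subdiagNorm m A ^ 2 * ‖blockVec m x i‖ ^ 2 := by
  rw [← mul_pow]
  exact pow_le_pow_left₀ (norm_nonneg _)
    (le_of_opNorm_le _ (norm_blockCLM_le_subdiagNorm hm A i) _) 2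

theorem sq_norm_superdiagPart_le {m : ℕ} (hm : 0 < m) (A : EllTwo →L[ℂ] EllTwo) (x : EllTwo)
    (i : ℕ) :
    ‖superdiagPart m A x i‖ ^ 2 ≤ superdiagNorm m A ^ 2 * ‖blockVec m x (i + 1)‖ ^ 2 := by
  rw [← mul_pow]
  exact pow_le_pow_left₀ (norm_nonneg _)
    (le_of_opNorm_le _ (norm_blockCLM_le_superdiagNorm hm A i) _) 2

theorem exists_hasSum_subdiagPart {m : ℕ} (hm : 0 < m) (A : EllTwo →L[ℂ] EllTwo) (x : EllTwo) :
    ∃ s ≤ subdiagNorm m A ^ 2 * ‖x‖ ^ 2, HasSum (fun i => ‖subdiagPart m A x i‖ ^ 2) s := by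
  have hx := (hasSum_sq_norm_blockVec hm x).mul_left (subdiagNorm m A ^ 2)
  have hs : Summable fun i => ‖subdiagPart m A x (i + 1)‖ ^ 2 :=
    Summable.of_nonneg_of_le (fun _ => sq_nonneg _) (sq_norm_subdiagPart_le hm A x) hx.summable
  refine ⟨_, hasSum_le (sq_norm_subdiagPart_le hm A x) hs.hasSum hx, ?_⟩
  have h := HasSum.zero_add (f := fun i => ‖subdiagPart m A x i‖ ^ 2) hs.hasSum
  simpa [subdiagPart] using h

theorem exists_hasSum_superdiagPart {m : ℕ} (hm : 0 < m) (A : EllTwo →L[ℂ] EllTwo)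
    (x : EllTwo) :
    ∃ s ≤ superdiagNorm m A ^ 2 * ‖x‖ ^ 2, HasSum (fun i => ‖superdiagPart m A x i‖ ^ 2) s := by
  have hx := hasSum_sq_norm_blockVec hm x
  have hx1 := (hasSum_nat_add_iff' (f := fun i => ‖blockVec m x i‖ ^ 2) 1).2 hx
  have hx2 := hx1.mul_left (superdiagNorm m A ^ 2)
  have hs : Summable fun i => ‖superdiagPart m A x i‖ ^ 2 :=
    Summable.of_nonneg_of_le (fun _ => sq_nonneg _) (sq_norm_superdiagPart_le hm A x) hx2.summable
  refine ⟨_, (hasSum_le (sq_norm_superdiagPart_le hm A x) hs.hasSum hx2).trans ?_, hs.hasSum⟩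
  refine mul_le_mul_of_nonneg_left ?_ (sq_nonneg _)
  rw [Finset.sum_range_one]
  linarith [sq_nonneg ‖blockVec m x 0‖]

theorem exists_blockVec_eq_smul {m : ℕ} (hm : 0 < m) (c : ℕ → ℝ)
    (hc : c.HasFiniteSupport) (x : EllTwo) :
    ∃ y : EllTwo, ∀ i, blockVec m y i = (c i : ℂ) • blockVec m x i := by
  let f : ℕ → ℂ := fun j => (c (j / m) : ℂ) * (x : ℕ → ℂ) j
  have hf : Memℓp f 2 := by
    obtain ⟨N, hN⟩ := hc.bddAbove
    refine (memℓp_zero ((Set.finite_lt_nat ((N + 1) * m)).subset fun l hl => ?_)).of_exponent_ge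
      zero_le
    have : l / m ≤ N := by
      refine hN fun h => hl ?_
      simp only [f, h, Complex.ofReal_zero, zero_mul]
    exact (Nat.div_lt_iff_lt_mul hm).1 (by omega)
  refine ⟨⟨f, hf⟩, fun i => ?_⟩
  ext p
  have : (i * m + p) / m = i := by
    rw [Nat.mul_comm, Nat.mul_add_div hm, Nat.div_eq_of_lt p.2, add_zero]
  change (c ((i * m + p) / m) : ℂ) * (x : ℕ → ℂ) (i * m + p) = _
  rw [this]
  rfl

theorem mem_window_of_blockVec_eq_zero {m n k : ℕ} (hm : 0 < m) {x : EllTwo}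
    (h : ∀ i, ¬ (k ≤ i ∧ i < k + n) → blockVec m x i = 0) : x ∈ window m n k := by
  intro j hj
  have h1 : blockVec m x (j / m) = 0 := by
    refine h _ fun hi => hj ⟨?_, ?_⟩
    · exact (Nat.le_div_iff_mul_le hm).1 hi.1
    · exact (Nat.div_lt_iff_lt_mul hm).1 hi.2
  have h2 := congrArg (fun v : EuclideanSpace ℂ (Fin m) => v ⟨j % m, Nat.mod_lt j hm⟩) h1
  have h3 : j / m * m + j % m = j := Nat.div_add_mod' j m
  simpa [EllTwo.blockVec_apply, h3] using h2

/-! ### Sine weights -/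

/-- The positive eigenvector of the discrete Dirichlet Laplacian on `{1, …, n}`, extended by zero
to the integers. -/
def sineWeight (n : ℕ) (j : ℤ) : ℝ :=
  if 0 < j ∧ j < n + 1 then Real.sin (j * (Real.pi / (n + 1))) else 0

theorem sineWeight_eq_sin {n : ℕ} {j : ℤ} (h0 : 0 ≤ j) (hj : j ≤ n + 1) :
    sineWeight n j = Real.sin (j * (Real.pi / (n + 1))) := by
  unfold sineWeight
  split_ifs with h
  · rfl
  · have : j = 0 ∨ j = n + 1 := by omega
    rcases this with rfl | rfl
    · simp
    · have hn : (n : ℝ) + 1 ≠ 0 := by positivity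
      push_cast
      rw [mul_div_cancel₀ _ hn, Real.sin_pi]

theorem sineWeight_eq_zero {n : ℕ} {j : ℤ} (h : ¬ (0 < j ∧ j < n + 1)) : sineWeight n j = 0 :=
  if_neg h

/-- The eigenvalue equation breaks down at the endpoints `0` and `n + 1`, where the weight vanishes.
Multiplying it by the weight makes it valid on all integers. -/
theorem sineWeight_mul_neighbours (n : ℕ) (j : ℤ) :
    sineWeight n j * (sineWeight n (j - 1) + sineWeight n (j + 1)) =
      2 * Real.cos (Real.pi / (n + 1)) * sineWeight n j ^ 2 := by
  by_cases h : 0 < j ∧ j < n + 1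
  · rw [sineWeight_eq_sin (n := n) (j := j - 1) (by omega) (by omega),
      sineWeight_eq_sin (n := n) (j := j + 1) (by omega) (by omega),
      sineWeight_eq_sin (n := n) (j := j) (by omega) (by omega)]
    push_cast
    rw [sub_mul, add_mul, one_mul, Real.sin_sub, Real.sin_add]
    ring
  · rw [sineWeight_eq_zero h]
    ring

theorem summable_of_eq_zero_off_sineWeight {n : ℕ} {f : ℤ → ℝ}
    (hf : ∀ j, sineWeight n j = 0 → f j = 0) : Summable f := by
  refine summable_of_hasFiniteSupport ((Set.finite_Icc (0 : ℤ) (n + 1)).subset fun j hj => ?_)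
  by_contra h
  exact hj (hf j (sineWeight_eq_zero fun h' => h ⟨h'.1.le, h'.2.le⟩))

theorem summable_sineWeight_sq (n : ℕ) : Summable fun j => sineWeight n j ^ 2 :=
  summable_of_eq_zero_off_sineWeight fun j hj => by rw [hj]; norm_num

theorem tsum_sineWeight_sq_pos {n : ℕ} (hn : 0 < n) : 0 < ∑' j, sineWeight n j ^ 2 := by
  refine (summable_sineWeight_sq n).tsum_pos (fun _ => sq_nonneg _) 1 (pow_pos ?_ 2)
  have hn' : (1 : ℝ) ≤ n := by exact_mod_cast hn
  rw [sineWeight_eq_sin (by norm_num) (by omega), Int.cast_one, one_mul]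
  refine Real.sin_pos_of_pos_of_lt_pi (by positivity) (div_lt_self Real.pi_pos (by linarith))

theorem sin_pi_div_nonneg (n : ℕ) : 0 ≤ Real.sin (Real.pi / (2 * ((n : ℝ) + 1))) := by
  have hn : (0 : ℝ) ≤ n := n.cast_nonneg
  have hpi := Real.pi_pos
  refine Real.sin_nonneg_of_nonneg_of_le_pi (by positivity) ?_
  exact div_le_self hpi.le (by linarith)

theorem one_sub_cos_pi_div (n : ℕ) :
    2 - 2 * Real.cos (Real.pi / (n + 1)) =
      (2 * Real.sin (Real.pi / (2 * ((n : ℝ) + 1)))) ^ 2 := by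
  have : Real.pi / ((n : ℝ) + 1) = 2 * (Real.pi / (2 * ((n : ℝ) + 1))) := by field_simp
  rw [this, Real.cos_two_mul, Real.cos_sq']
  ring

/-- Expanding the square gives `2 S - 2 c` with `c` the correlation of neighbouring weights. The
eigenvalue identity gives `c = S cos (π / (n + 1))`, and the half-angle formula finishes. -/
theorem hasSum_sq_sineWeight_sub (n : ℕ) :
    HasSum (fun j => (sineWeight n (j - 1) - sineWeight n j) ^ 2)
      ((2 * Real.sin (Real.pi / (2 * ((n : ℝ) + 1)))) ^ 2 * ∑' j, sineWeight n j ^ 2) := by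
  have h1 := (summable_sineWeight_sq n).hasSum
  generalize ∑' j, sineWeight n j ^ 2 = S at h1 ⊢
  have h2 : HasSum (fun j => sineWeight n (j - 1) ^ 2) S := by
    have := (Equiv.subRight (1 : ℤ)).hasSum_iff.2 h1
    simpa only [Function.comp_def, Equiv.subRight_apply] using this
  have h3 : Summable fun j => sineWeight n j * sineWeight n (j - 1) :=
    summable_of_eq_zero_off_sineWeight fun j hj => by rw [hj, zero_mul]
  obtain ⟨c, hc⟩ := h3
  have h4 : HasSum (fun j => sineWeight n (j + 1) * sineWeight n j) c := by
    have := (Equiv.addRight (1 : ℤ)).hasSum_iff.2 hc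
    simpa only [Function.comp_def, Equiv.coe_addRight, add_sub_cancel_right] using this
  have h5 : HasSum (fun j => 2 * Real.cos (Real.pi / (n + 1)) * sineWeight n j ^ 2) (c + c) := by
    have e : (fun j => sineWeight n j * sineWeight n (j - 1) +
        sineWeight n (j + 1) * sineWeight n j) =
        fun j => 2 * Real.cos (Real.pi / (n + 1)) * sineWeight n j ^ 2 := by
      ext j
      rw [← sineWeight_mul_neighbours]
      ring
    have := hc.add h4
    rwa [e] at this
  have h6 := h5.unique (h1.mul_left (2 * Real.cos (Real.pi / (n + 1))))
  have h7 := (h2.add h1).sub (hc.mul_left 2)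
  have h8 : S + S - 2 * c = (2 * Real.sin (Real.pi / (2 * ((n : ℝ) + 1)))) ^ 2 * S := by
    rw [← one_sub_cos_pi_div]
    linarith
  rw [h8] at h7
  have h9 : (fun j => sineWeight n (j - 1) ^ 2 + sineWeight n j ^ 2 -
      2 * (sineWeight n j * sineWeight n (j - 1))) =
      fun j => (sineWeight n (j - 1) - sineWeight n j) ^ 2 := by
    ext j
    ring
  rwa [h9] at h7

/-! ### Estimates for the truncations -/

theorem sum_reflect_le_of_hasSum {f : ℤ → ℝ} {s : ℝ} (hf : ∀ j, 0 ≤ f j) (h : HasSum f s) (c : ℤ)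
    (F : Finset ℤ) : ∑ k ∈ F, f (c - k) ≤ s :=
  sum_le_hasSum F (fun k _ => hf (c - k)) ((Equiv.subLeft c).hasSum_iff.2 h)

theorem sq_norm_add_three_le {E : Type*} [NormedAddCommGroup E] [NormedSpace ℝ E] (u v w : E)
    (α β γ : ℝ) {p q r : ℝ} (hp : 0 < p) (hq : 0 < q) (hr : 0 < r) :
    ‖α • u + β • v + γ • w‖ ^ 2 ≤ (p + q + r) *
      (α ^ 2 * (‖u‖ ^ 2 / p) + β ^ 2 * (‖v‖ ^ 2 / q) + γ ^ 2 * (‖w‖ ^ 2 / r)) := by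
  have h1 : ‖α • u + β • v + γ • w‖ ≤ |α| * ‖u‖ + |β| * ‖v‖ + |γ| * ‖w‖ := by
    refine (norm_add₃_le).trans_eq ?_
    simp only [norm_smul, Real.norm_eq_abs]
  refine (pow_le_pow_left₀ (norm_nonneg _) h1 2).trans ?_
  obtain ⟨a, ha⟩ : ∃ a, |α| * ‖u‖ = p * a := ⟨|α| * ‖u‖ / p, by field_simp⟩
  obtain ⟨b, hb⟩ : ∃ b, |β| * ‖v‖ = q * b := ⟨|β| * ‖v‖ / q, by field_simp⟩
  obtain ⟨c, hc⟩ : ∃ c, |γ| * ‖w‖ = r * c := ⟨|γ| * ‖w‖ / r, by field_simp⟩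
  have e : ∀ {t s y d : ℝ}, 0 < y → |t| * s = y * d → t ^ 2 * (s ^ 2 / y) = y * d ^ 2 := by
    intro t s y d hy h
    rw [← mul_div_assoc, ← sq_abs t, ← mul_pow, h]
    field_simp
  rw [ha, hb, hc, e hp ha, e hq hb, e hr hc]
  -- Weighted Cauchy–Schwarz: the difference of the two sides is `p q (a - b)² + q r (b - c)² + p r
  -- (a - c)²`.
  nlinarith [mul_nonneg (mul_pos hp hq).le (sq_nonneg (a - b)),
    mul_nonneg (mul_pos hq hr).le (sq_nonneg (b - c)),
    mul_nonneg (mul_pos hp hr).le (sq_nonneg (a - c))]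

theorem sq_div_lt_self_of_lt {s p : ℝ} (hs : 0 ≤ s) (h : s < p) : s ^ 2 / p < p := by
  rw [div_lt_iff₀ (hs.trans_lt h), ← sq]
  exact pow_lt_pow_left₀ h hs (by norm_num)

/-- The optimal Cauchy–Schwarz weights are `t, b, c` themselves, but they may vanish. Sharing the
slack `ε - t` equally makes them positive and the second estimate strict. -/
theorem exists_sum_eq_and_sum_sq_div_lt {t ε b c : ℝ} (ht : 0 ≤ t) (htε : t < ε) (hb : 0 ≤ b)
    (hc : 0 ≤ c) : ∃ p q r : ℝ, 0 < p ∧ 0 < q ∧ 0 < r ∧ p + q + r = ε + (b + c) ∧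
      t ^ 2 / p + b ^ 2 / q + c ^ 2 / r < ε + (b + c) := by
  have hδ : 0 < (ε - t) / 3 := by linarith
  have h1 := sq_div_lt_self_of_lt ht (lt_add_of_pos_right t hδ)
  have h2 := sq_div_lt_self_of_lt hb (lt_add_of_pos_right b hδ)
  have h3 := sq_div_lt_self_of_lt hc (lt_add_of_pos_right c hδ)
  exact ⟨t + (ε - t) / 3, b + (ε - t) / 3, c + (ε - t) / 3, by linarith, by linarith,
    by linarith, by ring, by linarith⟩

theorem subdiagPart_of_blockVec_eq {m : ℕ} (A : EllTwo →L[ℂ] EllTwo) {x y : EllTwo} {c : ℤ → ℝ}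
    (h : ∀ i : ℕ, blockVec m y i = c i • blockVec m x i) (i : ℕ) :
    subdiagPart m A y i = c (i - 1) • subdiagPart m A x i := by
  cases i with
  | zero => simp [subdiagPart]
  | succ i =>
    have : ((i + 1 : ℕ) : ℤ) - 1 = i := by push_cast; ring
    rw [this, subdiagPart, subdiagPart, h, ContinuousLinearMap.map_smul_of_tower]

/-- The blocks of `(A - z) y`, where `y` arises from `x` by multiplying the blocks by the
numbers `c i`. -/
theorem IsBlockTridiagonal.blockVec_commutator {m : ℕ} (hm : 0 < m) {A : EllTwo →L[ℂ] EllTwo}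
    (hA : IsBlockTridiagonal m A) (z : ℂ) {x y : EllTwo} {c : ℤ → ℝ}
    (h : ∀ i : ℕ, blockVec m y i = c i • blockVec m x i) (i : ℕ) :
    blockVec m (A y - z • y) i = c i • blockVec m (A x - z • x) i +
      (c (i - 1) - c i) • subdiagPart m A x i + (c (i + 1) - c i) • superdiagPart m A x i := by
  have hsup : superdiagPart m A y i = c (i + 1) • superdiagPart m A x i := by
    rw [superdiagPart, superdiagPart, h, ContinuousLinearMap.map_smul_of_tower]
    push_cast
    rfl
  rw [blockVec_sub, blockVec_sub, blockVec_smul, blockVec_smul, hA.blockVec_apply hm,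
    hA.blockVec_apply hm, hsup, subdiagPart_of_blockVec_eq A h, h,
    ContinuousLinearMap.map_smul_of_tower, smul_comm z]
  module

/-- The sum of squares estimate for the images of the truncations of `x` to all windows. -/
theorem sum_sq_norm_truncations_le {m n : ℕ} (hm : 0 < m) {A : EllTwo →L[ℂ] EllTwo}
    (hA : IsBlockTridiagonal m A) (z : ℂ) (x : EllTwo) (y : ℤ → EllTwo)
    (hy : ∀ k (i : ℕ), blockVec m (y k) i = sineWeight n (i - k) • blockVec m x i)
    {p q r : ℝ} (hp : 0 < p) (hq : 0 < q) (hr : 0 < r) (F : Finset ℤ) :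
    ∑ k ∈ F, ‖A (y k) - z • y k‖ ^ 2 ≤ (p + q + r) * ((∑' j, sineWeight n j ^ 2) *
      (‖A x - z • x‖ ^ 2 / p +
        (2 * Real.sin (Real.pi / (2 * ((n : ℝ) + 1))) * subdiagNorm m A * ‖x‖) ^ 2 / q +
        (2 * Real.sin (Real.pi / (2 * ((n : ℝ) + 1))) * superdiagNorm m A * ‖x‖) ^ 2 / r)) := by
  set σ := 2 * Real.sin (Real.pi / (2 * ((n : ℝ) + 1)))
  set S := ∑' j, sineWeight n j ^ 2
  have hS : HasSum (fun j => sineWeight n j ^ 2) S := (summable_sineWeight_sq n).hasSum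
  have hS0 : 0 ≤ S := tsum_nonneg fun _ => sq_nonneg _
  have hD : HasSum (fun j => (sineWeight n (j - 1) - sineWeight n j) ^ 2) (σ ^ 2 * S) :=
    hasSum_sq_sineWeight_sub n
  obtain ⟨su, hsu, hu⟩ := exists_hasSum_subdiagPart hm A x
  obtain ⟨sv, hsv, hv⟩ := exists_hasSum_superdiagPart hm A x
  have hb := hasSum_sq_norm_blockVec hm (A x - z • x)
  have hL := hasSum_sum (s := F) fun k _ => hasSum_sq_norm_blockVec hm (A (y k) - z • y k)
  have hR := ((((hb.div_const p).mul_left S).add ((hu.div_const q).mul_left (σ ^ 2 * S))).add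
    ((hv.div_const r).mul_left (σ ^ 2 * S))).mul_left (p + q + r)
  refine (hasSum_le (fun i => ?_) hL hR).trans ?_
  · have hk : ∀ k ∈ F, ‖blockVec m (A (y k) - z • y k) i‖ ^ 2 ≤ (p + q + r) *
        (sineWeight n (i - k) ^ 2 * (‖blockVec m (A x - z • x) i‖ ^ 2 / p) +
          (sineWeight n (i - k - 1) - sineWeight n (i - k)) ^ 2 *
            (‖subdiagPart m A x i‖ ^ 2 / q) +
          (sineWeight n (i + 1 - k - 1) - sineWeight n (i + 1 - k)) ^ 2 *
            (‖superdiagPart m A x i‖ ^ 2 / r)) := by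
      intro k _
      have h := hA.blockVec_commutator hm z (c := fun l => sineWeight n (l - k)) (hy k) i
      rw [h]
      refine (sq_norm_add_three_le _ _ _ _ _ _ hp hq hr).trans_eq ?_
      rw [show (i : ℤ) - 1 - k = i - k - 1 by ring, show (i : ℤ) + 1 - k - 1 = i - k by ring]
      ring
    refine (Finset.sum_le_sum hk).trans ?_
    rw [← Finset.mul_sum, Finset.sum_add_distrib, Finset.sum_add_distrib, ← Finset.sum_mul,
      ← Finset.sum_mul, ← Finset.sum_mul]
    refine mul_le_mul_of_nonneg_left (add_le_add (add_le_add ?_ ?_) ?_) (by positivity)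
    · exact mul_le_mul_of_nonneg_right
        (sum_reflect_le_of_hasSum (fun _ => sq_nonneg _) hS i F) (by positivity)
    · exact mul_le_mul_of_nonneg_right
        (sum_reflect_le_of_hasSum (fun _ => sq_nonneg _) hD i F) (by positivity)
    · exact mul_le_mul_of_nonneg_right
        (sum_reflect_le_of_hasSum (fun _ => sq_nonneg _) hD (i + 1) F) (by positivity)
  · refine mul_le_mul_of_nonneg_left ?_ (by positivity)
    have e1 : σ ^ 2 * S * (su / q) ≤ S * ((σ * subdiagNorm m A * ‖x‖) ^ 2 / q) := by
      calc σ ^ 2 * S * (su / q) ≤ σ ^ 2 * S * (subdiagNorm m A ^ 2 * ‖x‖ ^ 2 / q) := by gcongr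
        _ = _ := by ring
    have e2 : σ ^ 2 * S * (sv / r) ≤ S * ((σ * superdiagNorm m A * ‖x‖) ^ 2 / r) := by
      calc σ ^ 2 * S * (sv / r) ≤ σ ^ 2 * S * (superdiagNorm m A ^ 2 * ‖x‖ ^ 2 / r) := by gcongr
        _ = _ := by ring
    linarith

theorem exists_sum_sq_norm_truncations_ge {m : ℕ} (hm : 0 < m) (n : ℕ) (x : EllTwo)
    (y : ℤ → EllTwo)
    (hy : ∀ k (i : ℕ), blockVec m (y k) i = sineWeight n (i - k) • blockVec m x i) (N : ℕ) :
    ∃ F : Finset ℤ, (∑' j, sineWeight n j ^ 2) * ∑ i ∈ Finset.range N, ‖blockVec m x i‖ ^ 2 ≤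
      ∑ k ∈ F, ‖y k‖ ^ 2 := by
  -- These shifts include every `k` for which the bump meets one of the first `N` blocks, so each
  -- such block receives the full weight `S`.
  refine ⟨Finset.Icc (-(n + 1 : ℤ)) N, ?_⟩
  have h1 : ∀ k ∈ Finset.Icc (-(n + 1 : ℤ)) N,
      ∑ i ∈ Finset.range N, sineWeight n (i - k) ^ 2 * ‖blockVec m x i‖ ^ 2 ≤ ‖y k‖ ^ 2 := by
    intro k _
    refine le_trans (le_of_eq (Finset.sum_congr rfl fun i _ => ?_))
      (sum_le_hasSum (Finset.range N) (fun _ _ => sq_nonneg _) (hasSum_sq_norm_blockVec hm (y k)))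
    rw [hy, norm_smul, mul_pow, Real.norm_eq_abs, sq_abs]
  refine le_trans (le_of_eq ?_) (Finset.sum_le_sum h1)
  rw [Finset.sum_comm, Finset.mul_sum]
  refine Finset.sum_congr rfl fun i hi => ?_
  rw [← Finset.sum_mul]
  congr 1
  rw [← (Equiv.subLeft (i : ℤ)).tsum_eq]
  refine tsum_eq_sum fun k hk => ?_
  rw [Finset.mem_range] at hi
  rw [Finset.mem_Icc] at hk
  rw [Equiv.subLeft_apply, sineWeight_eq_zero (by omega)]
  norm_num

/-! ### Localisation to a window and the two inclusions -/

theorem exists_window_of_mem_approxPointPseudospectrum {m n : ℕ} (hm : 0 < m) (hn : 0 < n)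
    {A : EllTwo →L[ℂ] EllTwo} (hA : IsBlockTridiagonal m A) {ε : ℝ} {z : ℂ}
    (hz : z ∈ approxPointPseudospectrum ε A) :
    ∃ k, ∃ y ∈ window m n k, ‖A y - z • y‖ < (ε + epsN m A n) * ‖y‖ := by
  obtain ⟨x, hx⟩ := hz
  have hx0 : 0 < ‖x‖ := by
    rcases (norm_nonneg x).eq_or_lt with h | h
    · rw [← h, mul_zero] at hx
      exact absurd hx (not_lt.2 (norm_nonneg _))
    · exact h
  by_contra! hcon
  have hex : ∀ k : ℤ, ∃ y : EllTwo,
      ∀ i : ℕ, blockVec m y i = sineWeight n (i - k) • blockVec m x i := by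
    intro k
    refine exists_blockVec_eq_smul hm (fun i => sineWeight n (i - k))
      ((Set.finite_lt_nat (k + n + 1).toNat).subset fun i hi => ?_) x
    have : 0 < (i : ℤ) - k ∧ (i : ℤ) - k < n + 1 := by
      by_contra h
      exact hi (sineWeight_eq_zero h)
    change i < (k + n + 1).toNat
    omega
  choose y hy using hex
  have hlow : ∀ k, (ε + epsN m A n) * ‖y k‖ ≤ ‖A (y k) - z • y k‖ := by
    intro k
    -- The bump occupies the blocks `k + 1, …, k + n`. For `k + 1 < 0` its part with nonnegative
    -- index still fits in the window starting at `0`.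
    refine hcon (k + 1).toNat (y k) (mem_window_of_blockVec_eq_zero hm fun i hi => ?_)
    rw [hy, sineWeight_eq_zero (by omega), zero_smul]
  set σ := 2 * Real.sin (Real.pi / (2 * ((n : ℝ) + 1))) with hσ
  have hσ0 : 0 ≤ σ := mul_nonneg zero_le_two (sin_pi_div_nonneg n)
  set a := subdiagNorm m A with ha
  set g := superdiagNorm m A with hg
  have ha0 : 0 ≤ a := (norm_nonneg _).trans (norm_blockCLM_le_subdiagNorm hm A 0)
  have hg0 : 0 ≤ g := (norm_nonneg _).trans (norm_blockCLM_le_superdiagNorm hm A 0)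
  have heps : epsN m A n = σ * a + σ * g := by
    rw [epsN, hσ, ha, hg]
    ring
  have htε : ‖A x - z • x‖ / ‖x‖ < ε := (div_lt_iff₀ hx0).2 hx
  obtain ⟨p, q, r, hp, hq, hr, hsum, hC⟩ := exists_sum_eq_and_sum_sq_div_lt
    (div_nonneg (norm_nonneg _) hx0.le) htε (mul_nonneg hσ0 ha0) (mul_nonneg hσ0 hg0)
  rw [← heps] at hsum hC
  have hη : 0 < ε + epsN m A n := by
    rw [← hsum]
    exact add_pos (add_pos hp hq) hr
  have hS := tsum_sineWeight_sq_pos hn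
  have hbound : ∀ N : ℕ, (ε + epsN m A n) * ∑ i ∈ Finset.range N, ‖blockVec m x i‖ ^ 2 ≤
      ((‖A x - z • x‖ / ‖x‖) ^ 2 / p + (σ * a) ^ 2 / q + (σ * g) ^ 2 / r) * ‖x‖ ^ 2 := by
    intro N
    obtain ⟨F, hF⟩ := exists_sum_sq_norm_truncations_ge hm n x y hy N
    have hup := sum_sq_norm_truncations_le hm hA z x y hy hp hq hr F
    have hmid : (ε + epsN m A n) ^ 2 * ∑ k ∈ F, ‖y k‖ ^ 2 ≤
        ∑ k ∈ F, ‖A (y k) - z • y k‖ ^ 2 := by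
      rw [Finset.mul_sum]
      refine Finset.sum_le_sum fun k _ => ?_
      rw [← mul_pow]
      exact pow_le_pow_left₀ (mul_nonneg hη.le (norm_nonneg _)) (hlow k) 2
    have hC' : ‖A x - z • x‖ ^ 2 / p + (σ * a * ‖x‖) ^ 2 / q + (σ * g * ‖x‖) ^ 2 / r =
        ((‖A x - z • x‖ / ‖x‖) ^ 2 / p + (σ * a) ^ 2 / q + (σ * g) ^ 2 / r) * ‖x‖ ^ 2 := by
      rw [div_pow]
      field_simp
    rw [hC', hsum] at hup
    have htot := (mul_le_mul_of_nonneg_left hF (sq_nonneg (ε + epsN m A n))).trans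
      (hmid.trans hup)
    refine le_of_mul_le_mul_left ?_ (mul_pos hη hS)
    linarith
  -- Letting `N → ∞` loses strictness, but `hC` is a strict inequality between the constants.
  have hlim := le_of_tendsto'
    ((hasSum_sq_norm_blockVec hm x).tendsto_sum_nat.const_mul (ε + epsN m A n)) hbound
  exact absurd (le_of_mul_le_mul_right hlim (pow_pos hx0 2)) (not_le.2 hC)

theorem windowPseudospectrum_subset {m n : ℕ} (hm : 0 < m) (hn : 0 < n)
    (A : EllTwo →L[ℂ] EllTwo) (ε : ℝ) (k : ℕ) :
    windowPseudospectrum ε A m n k ⊆ approxPointPseudospectrum ε A := fun _ hz =>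
  let ⟨x, _, hx⟩ := (mem_windowPseudospectrum_iff hm hn).1 hz
  ⟨x, hx⟩

theorem unionPseudospectrum_subset_pseudospectrum {m n : ℕ} (hm : 0 < m) (hn : 0 < n)
    (A : EllTwo →L[ℂ] EllTwo) {ε : ℝ} (hε : 0 < ε) :
    unionPseudospectrum ε A m n ⊆ pseudospectrum ε A := by
  refine Set.iUnion_subset fun k z hz => (mem_pseudospectrum_iff hε).2 ?_
  exact hz.imp (fun h => windowPseudospectrum_subset hm hn A ε k h)
    (fun h => windowPseudospectrum_subset hm hn _ ε k h)

theorem pseudospectrum_subset_unionPseudospectrum {m n : ℕ} (hm : 0 < m) (hn : 0 < n)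
    {A : EllTwo →L[ℂ] EllTwo} (hA : IsBlockTridiagonal m A) {ε : ℝ} (hε : 0 < ε) :
    pseudospectrum ε A ⊆ unionPseudospectrum (ε + epsN m A n) A m n := by
  intro z hz
  rcases (mem_pseudospectrum_iff hε).1 hz with hz | hz
  · obtain ⟨k, hk⟩ := exists_window_of_mem_approxPointPseudospectrum hm hn hA hz
    exact Set.mem_iUnion.2 ⟨k, Or.inl ((mem_windowPseudospectrum_iff hm hn).2 hk)⟩
  · obtain ⟨k, hk⟩ := exists_window_of_mem_approxPointPseudospectrum hm hn hA.transpose hz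
    rw [epsN_transpose] at hk
    exact Set.mem_iUnion.2 ⟨k, Or.inr ((mem_windowPseudospectrum_iff hm hn).2 hk)⟩

theorem unionPseudospectrum_mono {ε η : ℝ} (h : ε ≤ η) (A : EllTwo →L[ℂ] EllTwo) (m n : ℕ) :
    unionPseudospectrum ε A m n ⊆ unionPseudospectrum η A m n :=
  Set.iUnion_mono fun _ => Set.union_subset_union
    (fun _ hz => lt_of_lt_of_le (show lowerNorm _ < ε from hz) h)
    (fun _ hz => lt_of_lt_of_le (show lowerNorm _ < ε from hz) h)

/-! ### Vanishing of `ε_n` and Hausdorff convergence -/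

theorem epsN_nonneg {m : ℕ} (hm : 0 < m) (A : EllTwo →L[ℂ] EllTwo) (n : ℕ) : 0 ≤ epsN m A n := by
  have ha0 : 0 ≤ subdiagNorm m A := (norm_nonneg _).trans (norm_blockCLM_le_subdiagNorm hm A 0)
  have hg0 : 0 ≤ superdiagNorm m A :=
    (norm_nonneg _).trans (norm_blockCLM_le_superdiagNorm hm A 0)
  exact mul_nonneg (mul_nonneg zero_le_two (add_nonneg ha0 hg0)) (sin_pi_div_nonneg n)

theorem tendsto_epsN (m : ℕ) (A : EllTwo →L[ℂ] EllTwo) :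
    Filter.Tendsto (epsN m A) Filter.atTop (𝓝 0) := by
  have h1 : Filter.Tendsto (fun n : ℕ => 2 * ((n : ℝ) + 1)) Filter.atTop Filter.atTop :=
    (Filter.tendsto_atTop_add_const_right _ _ tendsto_natCast_atTop_atTop).const_mul_atTop
      two_pos
  have h2 := (Real.continuous_sin.tendsto 0).comp (h1.const_div_atTop Real.pi)
  have h3 := h2.const_mul (2 * (subdiagNorm m A + superdiagNorm m A))
  rwa [Real.sin_zero, mul_zero] at h3

end EllTwo

end

theorem proposition3 (A : EllTwo →L[ℂ] EllTwo) (hA : EllTwo.IsBandOperator A)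
    (m : ℕ) (hm : 0 < m) (hblock : EllTwo.IsBlockTridiagonal m A) (ε : ℝ) (hε : 0 < ε) :
    (∀ n : ℕ, 1 ≤ n →
      EllTwo.unionPseudospectrum ε A m n ⊆ EllTwo.pseudospectrum ε A ∧
      EllTwo.pseudospectrum ε A ⊆
        EllTwo.unionPseudospectrum (ε + EllTwo.epsN m A n) A m n) ∧
    Filter.Tendsto
      (fun n : ℕ => Metric.hausdorffEDist
        (EllTwo.unionPseudospectrum ε A m n) (EllTwo.pseudospectrum ε A))
      Filter.atTop (𝓝 0) ∧
    Filter.Tendsto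
      (fun n : ℕ => Metric.hausdorffEDist
        (EllTwo.unionPseudospectrum (ε + EllTwo.epsN m A n) A m n) (EllTwo.pseudospectrum ε A))
      Filter.atTop (𝓝 0) := by
  have hsub : ∀ n : ℕ, 1 ≤ n →
      EllTwo.unionPseudospectrum ε A m n ⊆ EllTwo.pseudospectrum ε A ∧
      EllTwo.pseudospectrum ε A ⊆
        EllTwo.unionPseudospectrum (ε + EllTwo.epsN m A n) A m n := fun n hn =>
    ⟨EllTwo.unionPseudospectrum_subset_pseudospectrum hm hn A hε,
      EllTwo.pseudospectrum_subset_unionPseudospectrum hm hn hblock hε⟩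
  have htendsto : ∀ s : ℕ → Set ℂ, (∀ r : ℝ, 0 < r → ∀ᶠ n in Filter.atTop,
      (∀ z ∈ s n, ∃ w ∈ EllTwo.pseudospectrum ε A, dist z w ≤ r) ∧
        ∀ z ∈ EllTwo.pseudospectrum ε A, ∃ w ∈ s n, dist z w ≤ r) →
      Filter.Tendsto (fun n => Metric.hausdorffEDist (s n) (EllTwo.pseudospectrum ε A))
        Filter.atTop (𝓝 0) := by
    intro s hs
    rw [ENNReal.tendsto_nhds_zero]
    intro e he
    obtain ⟨r, hr0, hre⟩ := ENNReal.lt_iff_exists_nnreal_btwn.1 he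
    filter_upwards [hs r (by exact_mod_cast hr0)] with n hn
    refine (Metric.hausdorffEDist_le_of_mem_edist (fun z hz => ?_) fun z hz => ?_).trans hre.le
    · obtain ⟨w, hw, hzw⟩ := hn.1 z hz
      exact ⟨w, hw, edist_le_coe.2 hzw⟩
    · obtain ⟨w, hw, hzw⟩ := hn.2 z hz
      exact ⟨w, hw, edist_le_coe.2 hzw⟩
  refine ⟨hsub, htendsto _ fun r hr => ?_, htendsto _ fun r hr => ?_⟩
  · obtain ⟨δ, hδ, hδε, h⟩ := EllTwo.exists_near_pseudospectrum A hε hr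
    filter_upwards [Filter.eventually_ge_atTop 1,
      (EllTwo.tendsto_epsN m A).eventually_le_const hδ] with n hn hnδ
    refine ⟨fun z hz => ⟨z, (hsub n hn).1 hz, by rw [dist_self]; exact hr.le⟩, fun z hz => ?_⟩
    -- A point at level `ε` is within `r` of one at level `ε - δ`, which lies in the union at level
    -- `ε - δ + ε_n ≤ ε`.
    obtain ⟨w, hw, hzw⟩ := h z (EllTwo.pseudospectrum_mono hε (by linarith) A hz)
    exact ⟨w, EllTwo.unionPseudospectrum_mono (by linarith) A m n
      (EllTwo.pseudospectrum_subset_unionPseudospectrum hm hn hblock (sub_pos.2 hδε) hw), hzw⟩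
  · obtain ⟨δ, hδ, hδε, h⟩ := EllTwo.exists_near_pseudospectrum A hε hr
    filter_upwards [Filter.eventually_ge_atTop 1,
      (EllTwo.tendsto_epsN m A).eventually_le_const hδ] with n hn hnδ
    refine ⟨fun z hz => ?_, fun z hz => ⟨z, (hsub n hn).2 hz, by rw [dist_self]; exact hr.le⟩⟩
    have hn0 := EllTwo.epsN_nonneg hm A n
    -- The union at level `ε + ε_n ≤ ε + δ` lies in the pseudospectrum at level `ε + δ`, hence
    -- within `r` of that at level `ε - δ`.
    obtain ⟨w, hw, hzw⟩ := h z (EllTwo.pseudospectrum_mono (by linarith) (by linarith) A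
      (EllTwo.unionPseudospectrum_subset_pseudospectrum hm hn A (by linarith) hz))
    exact ⟨w, EllTwo.pseudospectrum_mono (sub_pos.2 hδε) (by linarith) A hw, hzw⟩
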